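/- Let $\Sigma$ be a finite alphabet and let $L \subseteq \Sigma^*$ be a language that is downward closed for the infix relation (if $v \in L$ and $u$ is an infix, i.e. a contiguous factor, of $v$, then $u \in L$) and well-quasi-ordered by the infix relation (every infinite sequence $(x_i)_{i\in\mathbb N}$ in $L$ has indices $i<j$ such that $x_i$ is an infix of $x_j$). Define the rank of a tree all of whose branches are finite inductively: it is $\sup\{\alpha_T+1\}$, where $T$ ranges over the subtrees rooted at the children of the root and $\alpha_T$ is the rank of $T$ (so a leaf has rank $0$). For a well-quasi-ordered set $X$, the maximal order type, the ordinal height and the ordinal width of $X$ are the ranks of the trees (rooted at the empty sequence, and ordered by extension) of, respectively, the finite bad sequences $x_0,\dots,x_{n-1}$ in $X$ (i.e. $x_i \not\le x_j$ for all $i<j$), the finite strictly decreasing sequences in $X$, and the finite sequences of pairwise incomparable elements of $X$. Then, for $L$ ordered by the infix relation, - the maximal order type of $L$ is strictly less than $\omega^3$, - the ordinal height of $L$ is at most $\omega$, - the ordinal width of $L$ is at most $\omega^2$. -/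

import Mathlib

open Ordinal

/-- The finite sequences `x₀, …, xₙ₋₁` in `X` such that `R xᵢ xⱼ` for all `i < j`. They are the
nodes of a tree, whose root is the empty sequence. -/
abbrev PairwiseSeq {X : Type*} (R : X → X → Prop) : Type _ :=
  {s : List X // s.Pairwise R}

/-- The root of the tree: the empty sequence. -/
def PairwiseSeq.root {X : Type*} (R : X → X → Prop) : PairwiseSeq R :=
  ⟨[], List.Pairwise.nil⟩

/-- `t` is a child of `s` in the tree: `t` extends `s` by one element at the end. -/
def PairwiseSeq.IsChild {X : Type*} {R : X → X → Prop} (t s : PairwiseSeq R) : Prop :=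
  ∃ x : X, t.1 = s.1 ++ [x]

/-- The tree has no infinite branch if no infinite sequence satisfies `R` pairwise. -/
theorem PairwiseSeq.wellFounded {X : Type*} {R : X → X → Prop}
    (h : ∀ f : ℕ → X, ∃ i j, i < j ∧ ¬ R (f i) (f j)) :
    WellFounded (PairwiseSeq.IsChild (R := R)) := by
  rw [wellFounded_iff_isEmpty_descending_chain]
  refine ⟨fun ⟨f, hf⟩ => ?_⟩
  choose g hg using hf
  obtain ⟨i, j, hij, hR⟩ := h g
  have hmem : ∀ k, i + 1 ≤ k → g i ∈ (f k).1 := by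
    intro k hk
    induction k, hk using Nat.le_induction with
    | base => simp [hg i]
    | succ k _ ih => simp [hg k, ih]
  have hp := (f (j + 1)).2
  rw [hg j, List.pairwise_append] at hp
  exact hR (hp.2.2 _ (hmem j hij) _ (by simp))

/-- The rank of a tree without infinite branches, i.e. the rank of its root, where the rank of a
node is the supremum of `rank c + 1` over its children `c` (so `0` for a leaf). -/
noncomputable def PairwiseSeq.treeRank {X : Type*} (R : X → X → Prop)
    (h : WellFounded (PairwiseSeq.IsChild (R := R))) : Ordinal :=
  (h.apply (PairwiseSeq.root R)).rank

/-- `x₀, …, xₙ₋₁` is bad if `xᵢ ≤ xⱼ` for no `i < j`. -/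
def BadPair {X : Type*} (r : X → X → Prop) (x y : X) : Prop := ¬ r x y

/-- Strict descent for the quasi-order `r`: the later element `y` is strictly below `x`. -/
def DecreasingPair {X : Type*} (r : X → X → Prop) (x y : X) : Prop := r y x ∧ ¬ r x y

/-- Incomparability for the quasi-order `r`. -/
def IncomparablePair {X : Type*} (r : X → X → Prop) (x y : X) : Prop := ¬ r x y ∧ ¬ r y x

theorem wellFounded_bad {X : Type*} {r : X → X → Prop} (h : WellQuasiOrdered r) :
    WellFounded (PairwiseSeq.IsChild (R := BadPair r)) :=
  PairwiseSeq.wellFounded fun f =>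
    let ⟨i, j, hij, hr⟩ := h f
    ⟨i, j, hij, fun hb => hb hr⟩

theorem wellFounded_decreasing {X : Type*} {r : X → X → Prop} (h : WellQuasiOrdered r) :
    WellFounded (PairwiseSeq.IsChild (R := DecreasingPair r)) :=
  PairwiseSeq.wellFounded fun f =>
    let ⟨i, j, hij, hr⟩ := h f
    ⟨i, j, hij, fun hb => hb.2 hr⟩

theorem wellFounded_incomparable {X : Type*} {r : X → X → Prop} (h : WellQuasiOrdered r) :
    WellFounded (PairwiseSeq.IsChild (R := IncomparablePair r)) :=
  PairwiseSeq.wellFounded fun f =>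
    let ⟨i, j, hij, hr⟩ := h f
    ⟨i, j, hij, fun hb => hb.1 hr⟩

/-- The maximal order type of a well-quasi-order: the rank of the tree of bad sequences. -/
noncomputable def maximalOrderType {X : Type*} (r : X → X → Prop) (h : WellQuasiOrdered r) :
    Ordinal :=
  PairwiseSeq.treeRank (BadPair r) (wellFounded_bad h)

/-- The ordinal height of a well-quasi-order: the rank of the tree of decreasing sequences. -/
noncomputable def ordinalHeight {X : Type*} (r : X → X → Prop) (h : WellQuasiOrdered r) :
    Ordinal :=
  PairwiseSeq.treeRank (DecreasingPair r) (wellFounded_decreasing h)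

/-- The ordinal width of a well-quasi-order: the rank of the tree of antichains (finite sequences
of pairwise incomparable elements). -/
noncomputable def ordinalWidth {X : Type*} (r : X → X → Prop) (h : WellQuasiOrdered r) :
    Ordinal :=
  PairwiseSeq.treeRank (IncomparablePair r) (wellFounded_incomparable h)

/-- The infix relation (`u` is a contiguous factor of `v`) restricted to the language `L`. -/
def infixOn {α : Type*} (L : Set (List α)) (u v : L) : Prop := u.1 <:+: v.1

/-- `L` is downward closed for the infix relation. -/
def InfixDownwardClosed {α : Type*} (L : Set (List α)) : Prop :=
  ∀ u v : List α, u <:+: v → v ∈ L → u ∈ L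

/-! Noetherian induction along bad sequences: assume each residual of K (the words of K not
containing a given word of K) is tame (`tame_of_tame_residuals`). If two words of K have no common
upper bound in K, then K is the union of their residuals. Otherwise K is directed. If some c in K
never occurs twice in a word of K, the words containing c are compared by the lengths of what lies
left and right of c, a grid in ℕ × ℕ; the others form a residual. If instead every word recurs, all
residuals are finite: an infinite one would yield infinitely many return words to u, which form an
antichain. A grid has type at most ω² and width at most ω. Unions add bounds by natural sum, so only
finite multiples of these appear. The height bound just uses lengths. -/

/-- Polynomials `ω² a + ω b + c` with natural coefficients, compared lexicographically and added
coefficientwise (that is, with the natural sum). -/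
abbrev OmegaPoly : Type := ℕ ×ₗ ℕ ×ₗ ℕ

/-! ### Ordinals below ω³. -/

namespace OmegaPoly

def triple (a b c : ℕ) : OmegaPoly := toLex (a, toLex (b, c))

theorem triple_lt_triple {a b c a' b' c' : ℕ} :
    triple a b c < triple a' b' c' ↔ a < a' ∨ a = a' ∧ (b < b' ∨ b = b' ∧ c < c') := by
  simp [triple, Prod.Lex.toLex_lt_toLex]

theorem nsmul_triple (n a b c : ℕ) : n • triple a b c = triple (n * a) (n * b) (n * c) := rfl

/-- The Horner form lets `omega_mul_add_lt` settle both leading coefficients. -/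
noncomputable def toOrdinal (v : OmegaPoly) : Ordinal :=
  ω * (ω * ((ofLex v).1 : ℕ) + ((ofLex (ofLex v).2).1 : ℕ)) + ((ofLex (ofLex v).2).2 : ℕ)

theorem toOrdinal_triple (a b c : ℕ) : (triple a b c).toOrdinal = ω * (ω * a + b) + c := rfl

theorem omega_mul_add_lt {x y : Ordinal} (h : x < y) (m n : ℕ) : ω * x + m < ω * y + n :=
  calc ω * x + m < ω * x + ω := by gcongr; exact natCast_lt_omega0 m
    _ = ω * Order.succ x := (mul_succ _ _).symm
    _ ≤ ω * y := by gcongr; exact Order.succ_le_of_lt h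
    _ ≤ ω * y + n := le_self_add

theorem toOrdinal_strictMono : StrictMono toOrdinal := by
  intro v w h
  obtain ⟨a, b, c⟩ := v
  obtain ⟨a', b', c'⟩ := w
  change triple a b c < triple a' b' c' at h
  change (triple a b c).toOrdinal < (triple a' b' c').toOrdinal
  rw [toOrdinal_triple, toOrdinal_triple]
  rcases triple_lt_triple.1 h with h | ⟨rfl, h | ⟨rfl, h⟩⟩
  · exact omega_mul_add_lt (omega_mul_add_lt (Nat.cast_lt.2 h) _ _) _ _
  · exact omega_mul_add_lt (by gcongr) _ _
  · gcongr

end OmegaPoly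

open OmegaPoly

/-! ### Bounds on ranks of trees of sequences. -/

section RankBounds

variable {X : Type*} {R : X → X → Prop} {A B : Set X} {v w e : OmegaPoly}

/-- The tree of sequences in `A` that satisfy `R` pairwise has rank at most `v`, as witnessed by a
function that decreases strictly from each node to its children. -/
def RankBound (R : X → X → Prop) (A : Set X) (v : OmegaPoly) : Prop :=
  ∃ ρ : List X → OmegaPoly, ρ [] ≤ v ∧
    ∀ s x, (s ++ [x]).Pairwise R → (∀ y ∈ s ++ [x], y ∈ A) → ρ (s ++ [x]) < ρ s

namespace RankBound

theorem mono {R' : X → X → Prop} (h : RankBound R A v) (hR : ∀ x ∈ B, ∀ y ∈ B, R' x y → R x y)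
    (hB : B ⊆ A) (hv : v ≤ w) : RankBound R' B w := by
  obtain ⟨ρ, h0, h1⟩ := h
  exact ⟨ρ, h0.trans hv, fun s x hs hA => h1 s x
    (hs.imp_of_mem fun ha hb => hR _ (hA _ ha) _ (hA _ hb)) fun y hy => hB (hA y hy)⟩

/-- A tree is bounded by `v` if the subtrees at the children of the root are bounded below `v`. -/
theorem of_residuals (h : ∀ x ∈ A, ∃ w < v, RankBound R {y ∈ A | R x y} w) : RankBound R A v := by
  choose! w hw ρ h0 h1 using h
  refine ⟨fun s => match s with
    | [] => v
    | x :: s => ρ x s, le_rfl, ?_⟩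
  rintro (_ | ⟨z, s⟩) x hs hA
  · have hx : x ∈ A := hA x (by simp)
    exact (h0 x hx).trans_lt (hw x hx)
  · have hs' := List.pairwise_cons.1 hs
    exact h1 z (hA z (by simp)) s x hs'.2 fun y hy =>
      ⟨hA y (List.mem_cons_of_mem _ hy), hs'.1 y hy⟩

/-- A new element lengthens exactly one of the two subsequences, inside or outside `A`;
coefficientwise addition is strictly monotone in each argument, so the sum drops. -/
theorem union (hA : RankBound R A v) (hB : RankBound R B w) : RankBound R (A ∪ B) (v + w) := by
  classical
  obtain ⟨ρ, h0, h1⟩ := hA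
  obtain ⟨σ, k0, k1⟩ := hB
  refine ⟨fun s => ρ (s.filter (· ∈ A)) + σ (s.filter (· ∉ A)), add_le_add h0 k0, ?_⟩
  intro s x hs hAB
  have hp := hs.filter (· ∈ A)
  have hq := hs.filter (· ∉ A)
  by_cases hx : x ∈ A
  · simp only [List.filter_append, List.filter_singleton, hx, not_true_eq_false, decide_false,
      decide_true, cond_true, cond_false, List.append_nil] at hp ⊢
    refine add_lt_add_left (h1 _ _ hp fun y hy => ?_) _
    rcases List.mem_append.1 hy with hy | hy
    · simpa using (List.mem_filter.1 hy).2
    · rwa [List.mem_singleton.1 hy]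
  · simp only [List.filter_append, List.filter_singleton, hx, not_false_eq_true, decide_false,
      decide_true, cond_true, cond_false, List.append_nil] at hq ⊢
    refine add_lt_add_right (k1 _ _ hq fun y hy => ?_) _
    rcases List.mem_append.1 hy with hy | hy
    · have hy' := List.mem_filter.1 hy
      exact (hAB y (by simp [hy'.1])).resolve_left (by simpa using hy'.2)
    · rw [List.mem_singleton.1 hy]
      exact (hAB x (by simp)).resolve_left hx

theorem treeRank_le {Y : Type*} {R' : Y → Y → Prop} {f : Y → X}
    (hf : ∀ x y, R' x y → R (f x) (f y)) (hA : ∀ x, f x ∈ A) (h : RankBound R A v)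
    (hwf : WellFounded (PairwiseSeq.IsChild (R := R'))) :
    PairwiseSeq.treeRank R' hwf ≤ v.toOrdinal := by
  obtain ⟨ρ, h0, h1⟩ := h
  have key : ∀ s : PairwiseSeq R', (hwf.apply s).rank ≤ (ρ (s.1.map f)).toOrdinal := by
    intro s
    induction s using hwf.induction with
    | _ s ih =>
      rw [Acc.rank_eq]
      refine Ordinal.iSup_le fun ⟨t, ht⟩ => Order.succ_le_of_lt ((ih t ht).trans_lt ?_)
      obtain ⟨x, hx⟩ := ht
      apply toOrdinal_strictMono
      have hp : (t.1.map f).Pairwise R := List.pairwise_map.2 (t.2.imp fun h => hf _ _ h)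
      simp only [hx, List.map_append, List.map_cons, List.map_nil] at hp ⊢
      refine h1 _ _ hp fun y hy => ?_
      simp only [← List.map_nil (f := f), ← List.map_cons, ← List.map_append] at hy
      obtain ⟨z, -, rfl⟩ := List.mem_map.1 hy
      exact hA z
  exact (key _).trans (toOrdinal_strictMono.monotone h0)

theorem empty (R : X → X → Prop) (v : OmegaPoly) : RankBound R ∅ v :=
  of_residuals fun _ h => h.elim

end RankBound

/-- The tree of sequences in `A` that satisfy `R` pairwise has rank at most a natural multiple
of `e`. -/
def MulRankBound (R : X → X → Prop) (A : Set X) (e : OmegaPoly) : Prop :=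
  ∃ n : ℕ, RankBound R A (n • e)

theorem RankBound.mulRankBound (h : RankBound R A e) : MulRankBound R A e :=
  ⟨1, by simpa using h⟩

namespace MulRankBound

theorem mono {R' : X → X → Prop} (h : MulRankBound R A e)
    (hR : ∀ x ∈ B, ∀ y ∈ B, R' x y → R x y) (hB : B ⊆ A) : MulRankBound R' B e :=
  let ⟨n, hn⟩ := h
  ⟨n, hn.mono hR hB le_rfl⟩

theorem subset (h : MulRankBound R A e) (hB : B ⊆ A) : MulRankBound R B e :=
  h.mono (fun _ _ _ _ h => h) hB

theorem union (hA : MulRankBound R A e) (hB : MulRankBound R B e) :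
    MulRankBound R (A ∪ B) e := by
  obtain ⟨m, hm⟩ := hA
  obtain ⟨n, hn⟩ := hB
  exact ⟨m + n, by rw [add_nsmul]; exact hm.union hn⟩

theorem biUnion {ι : Type*} {s : Set ι} (hs : s.Finite) {C : ι → Set X}
    (h : ∀ i ∈ s, MulRankBound R (C i) e) : MulRankBound R (⋃ i ∈ s, C i) e := by
  induction s, hs using Set.Finite.induction_on with
  | empty => exact ⟨0, by simpa using RankBound.empty R _⟩
  | insert _ _ ih =>
    rw [Set.biUnion_insert]
    exact (h _ (by simp)).union (ih fun i hi => h i (by simp [hi]))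

theorem of_residuals {e' : OmegaPoly} (he : ∀ n : ℕ, n • e < e')
    (h : ∀ x ∈ A, MulRankBound R {y ∈ A | R x y} e) : RankBound R A e' :=
  RankBound.of_residuals fun x hx => let ⟨n, hn⟩ := h x hx; ⟨n • e, he n, hn⟩

end MulRankBound

theorem RankBound.of_forall_not (he : 0 < e) (h : ∀ x ∈ A, ∀ y ∈ A, ¬ R x y) : RankBound R A e :=
  RankBound.of_residuals fun x hx => ⟨0, he, by
    rw [show {y ∈ A | R x y} = ∅ from Set.eq_empty_of_forall_notMem fun y hy => h x hx y hy.1 hy.2]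
    exact RankBound.empty R 0⟩

theorem Set.Finite.mulRankBound (hR : ∀ x, ¬ R x x) (he : 0 < e) (hA : A.Finite) :
    MulRankBound R A e := by
  rw [← Set.biUnion_of_singleton A]
  refine MulRankBound.biUnion hA fun x _ => (RankBound.of_forall_not he ?_).mulRankBound
  rintro y rfl z rfl
  exact hR z

namespace OmegaPoly

theorem one_pos : 0 < triple 0 0 1 := triple_lt_triple.2 (by simp)

theorem nsmul_one_lt (n : ℕ) : n • triple 0 0 1 < triple 0 1 0 := by
  rw [nsmul_triple, triple_lt_triple]; simp

theorem nsmul_omega_lt (n : ℕ) : n • triple 0 1 0 < triple 1 0 0 := by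
  rw [nsmul_triple, triple_lt_triple]; simp

end OmegaPoly

/-- A set is tame for `r` if it has maximal order type at most `ω² n` and ordinal width at most
`ω n` for some natural number `n`. -/
structure Tame (r : X → X → Prop) (A : Set X) : Prop where
  bad : MulRankBound (BadPair r) A (triple 1 0 0)
  incomparable : MulRankBound (IncomparablePair r) A (triple 0 1 0)

namespace Tame

variable {r : X → X → Prop}

theorem subset (h : Tame r A) (hB : B ⊆ A) : Tame r B :=
  ⟨h.bad.subset hB, h.incomparable.subset hB⟩

theorem union (hA : Tame r A) (hB : Tame r B) : Tame r (A ∪ B) :=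
  ⟨hA.bad.union hB.bad, hA.incomparable.union hB.incomparable⟩

theorem of_finite_residuals (hr : ∀ x, r x x) (h : ∀ x ∈ A, {y ∈ A | ¬ r x y}.Finite) :
    Tame r A := by
  have hb : RankBound (BadPair r) A (triple 0 1 0) :=
    MulRankBound.of_residuals nsmul_one_lt fun x hx =>
      (h x hx).mulRankBound (fun x hx => hx (hr x)) one_pos
  exact ⟨(hb.mono (fun _ _ _ _ h => h) subset_rfl (by
      simpa using (nsmul_omega_lt 1).le)).mulRankBound,
    hb.mulRankBound.mono (fun _ _ _ _ h => h.1) subset_rfl⟩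

/-- A set whose quasi-order extends that of a subset of `ℕ × ℕ` is tame. -/
theorem of_grid (p q : X → ℕ)
    (h : ∀ x ∈ A, ∀ y ∈ A, p x ≤ p y → q x ≤ q y → r x y) : Tame r A := by
  -- Any y not above x has a smaller `p` or a smaller `q`, so it lies in one of finitely many rows
  -- and columns.
  have cover : ∀ (R : X → X → Prop) (e : OmegaPoly), (∀ x y, R x y → ¬ r x y) →
      (∀ i, MulRankBound R {y ∈ A | p y = i} e) → (∀ j, MulRankBound R {y ∈ A | q y = j} e) →
      ∀ x ∈ A, MulRankBound R {y ∈ A | R x y} e := by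
    intro R e hR hp hq x hx
    refine ((MulRankBound.biUnion (Set.finite_Iio (p x)) fun i _ => hp i).union
      (MulRankBound.biUnion (Set.finite_Iio (q x)) fun j _ => hq j)).subset ?_
    rintro y ⟨hy, hxy⟩
    simp only [Set.mem_union, Set.mem_iUnion, Set.mem_Iio, Set.mem_ofPred_eq, exists_prop]
    by_contra! hc
    exact hR x y hxy (h x hx y hy (not_lt.1 fun hlt => (hc.1 _ hlt hy) rfl)
      (not_lt.1 fun hlt => (hc.2 _ hlt hy) rfl))
  have fiber : ∀ (i j : ℕ), MulRankBound (BadPair r) {y ∈ A | p y = i ∧ q y = j} (triple 0 0 1) :=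
    fun i j => (RankBound.of_forall_not one_pos fun x hx y hy hb =>
      hb (h x hx.1 y hy.1 (hx.2.1.trans hy.2.1.symm).le
        (hx.2.2.trans hy.2.2.symm).le)).mulRankBound
  refine ⟨(MulRankBound.of_residuals nsmul_omega_lt
      (cover _ _ (fun _ _ h => h) (fun i => ?_) fun j => ?_)).mulRankBound,
    (MulRankBound.of_residuals nsmul_one_lt
      (cover _ _ (fun _ _ h => h.1) (fun i => ?_) fun j => ?_)).mulRankBound⟩
  · refine (MulRankBound.of_residuals nsmul_one_lt fun x hx =>
      (MulRankBound.biUnion (Set.finite_Iio (q x)) fun j _ => fiber i j).subset ?_).mulRankBound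
    rintro y ⟨⟨hy, hpy⟩, hb⟩
    simp only [Set.mem_iUnion, Set.mem_Iio, Set.mem_ofPred_eq, exists_prop]
    exact ⟨q y, not_le.1 fun hle => hb (h x hx.1 y hy (hx.2.trans hpy.symm).le hle), hy, hpy, rfl⟩
  · refine (MulRankBound.of_residuals nsmul_one_lt fun x hx =>
      (MulRankBound.biUnion (Set.finite_Iio (p x)) fun i _ => fiber i j).subset ?_).mulRankBound
    rintro y ⟨⟨hy, hqy⟩, hb⟩
    simp only [Set.mem_iUnion, Set.mem_Iio, Set.mem_ofPred_eq, exists_prop]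
    exact ⟨p y, not_le.1 fun hle => hb (h x hx.1 y hy hle (hx.2.trans hqy.symm).le), hy, rfl, hqy⟩
  -- Within one row or column all elements are comparable.
  · refine (RankBound.of_forall_not one_pos fun x hx y hy hxy => ?_).mulRankBound
    rcases le_total (q x) (q y) with hle | hle
    · exact hxy.1 (h x hx.1 y hy.1 (hx.2.trans hy.2.symm).le hle)
    · exact hxy.2 (h y hy.1 x hx.1 (hy.2.trans hx.2.symm).le hle)
  · refine (RankBound.of_forall_not one_pos fun x hx y hy hxy => ?_).mulRankBound
    rcases le_total (p x) (p y) with hle | hle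
    · exact hxy.1 (h x hx.1 y hy.1 hle (hx.2.trans hy.2.symm).le)
    · exact hxy.2 (h y hy.1 x hx.1 hle (hy.2.trans hx.2.symm).le)

end Tame

end RankBounds

/-! ### Combinatorics of infixes. -/

section Words

variable {α : Type*} {K L : Set (List α)} {u v w z : List α}

/-- The copy of `u` that starts `r` is not at the end of `r'`, so it must be at its start;
symmetrically for the copy ending `r`. -/
theorem List.IsInfix.eq_of_return {u r r' : List α}
    (hpre : u <+: r) (hsuf : u <:+ r) (hlen : u.length < r.length)
    (hret : ∀ a b, r' = a ++ u ++ b → a = [] ∨ b = []) (h : r <:+: r') : r = r' := by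
  obtain ⟨a, b, rfl⟩ := h
  obtain ⟨s, rfl⟩ := hpre
  obtain ⟨t, ht⟩ := hsuf
  have hs : s ≠ [] := by rintro rfl; simp at hlen
  have ht' : t ≠ [] := by rintro rfl; simp [← ht] at hlen
  have ha : a = [] := (hret a (s ++ b) (by simp)).resolve_right (by simp [hs])
  have hb : b = [] := (hret (a ++ t) b (by rw [← ht]; simp)).resolve_left (by simp [ht'])
  simp [ha, hb]

/-- A word that starts and ends with `u` and contains a long factor avoiding `u` contains a long
return word to `u`. -/
theorem exists_return_word {u t W : List α} (hu : ¬ u <:+: t)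
    (ht : t <:+: W) (hpre : u <+: W) (hsuf : u <:+ W) :
    ∃ r, r <:+: W ∧ u <+: r ∧ u <:+ r ∧ t.length ≤ r.length ∧
      ∀ a b, r = a ++ u ++ b → a = [] ∨ b = [] := by
  induction hn : W.length using Nat.strong_induction_on generalizing W with
  | _ n ih =>
    by_cases hW : ∀ a b, W = a ++ u ++ b → a = [] ∨ b = []
    · exact ⟨W, List.infix_rfl, hpre, hsuf, ht.length_le, hW⟩
    push Not at hW
    obtain ⟨a, b, rfl, ha, hb⟩ := hW
    obtain ⟨c, d, hcd⟩ := ht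
    have ha' := List.length_pos_iff.2 ha
    have hb' := List.length_pos_iff.2 hb
    have hl := congrArg List.length hcd
    simp only [List.length_append] at hl hn
    by_cases h1 : a.length ≤ c.length
    · have htub : t <:+: u ++ b := by
        have h2 : a <+: c := List.prefix_of_prefix_length_le (l₃ := a ++ u ++ b)
          ⟨u ++ b, by simp⟩ ⟨t ++ d, by simp [← hcd]⟩ h1
        obtain ⟨e, rfl⟩ := h2
        exact ⟨e, d, by simpa using hcd⟩
      have hs : u <:+ u ++ b := List.suffix_of_suffix_length_le (l₃ := a ++ u ++ b) hsuf
        ⟨a, by simp⟩ (by simp)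
      obtain ⟨r, hr, h⟩ := ih (u ++ b).length (by simp; omega) htub ⟨b, rfl⟩ hs rfl
      exact ⟨r, hr.trans ⟨a, [], by simp⟩, h⟩
    by_cases h2 : b.length ≤ d.length
    · have htau : t <:+: a ++ u := by
        have h2 : b <:+ d := List.suffix_of_suffix_length_le (l₃ := a ++ u ++ b)
          ⟨a ++ u, by simp⟩ ⟨c ++ t, by simp [← hcd]⟩ h2
        obtain ⟨e, rfl⟩ := h2
        exact ⟨c, e, by rw [← List.append_assoc] at hcd; exact List.append_cancel_right hcd⟩
      have hs : u <+: a ++ u := List.prefix_of_prefix_length_le (l₃ := a ++ u ++ b) hpre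
        ⟨b, by simp⟩ (by simp)
      obtain ⟨r, hr, h⟩ := ih (a ++ u).length (by simp; omega) htau hs ⟨a, rfl⟩ rfl
      exact ⟨r, hr.trans ⟨[], b, by simp⟩, h⟩
    -- Here `t` would cover the inner occurrence of `u`.
    · exfalso
      obtain ⟨e, rfl⟩ : c <+: a := List.prefix_of_prefix_length_le (l₃ := a ++ u ++ b)
          ⟨t ++ d, by simp [← hcd]⟩ ⟨u ++ b, by simp⟩ (by omega)
      obtain ⟨f, rfl⟩ : d <:+ b := List.suffix_of_suffix_length_le (l₃ := c ++ e ++ u ++ b)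
          ⟨c ++ t, hcd⟩ ⟨c ++ e ++ u, by simp⟩ (by omega)
      refine hu ⟨e, f, ?_⟩
      simp only [List.append_assoc, List.append_cancel_left_eq] at hcd
      simp only [← List.append_assoc] at hcd
      simpa using (List.append_cancel_right hcd).symm

/-- If each word of `K` occurs at two positions of a word of `K`, then it occurs at two positions
that are arbitrarily far apart. -/
theorem exists_distant_occurrences
    (hrec : ∀ c ∈ K, ∃ a b a' b', a ++ c ++ b ∈ K ∧ a ++ c ++ b = a' ++ c ++ b' ∧
      a.length < a'.length) (hz : z ∈ K) (k : ℕ) :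
    ∃ a b a' b', a ++ z ++ b ∈ K ∧ a ++ z ++ b = a' ++ z ++ b' ∧ a.length + k ≤ a'.length := by
  induction k with
  | zero => exact ⟨[], [], [], [], by simpa using hz, rfl, le_rfl⟩
  | succ k ih =>
    obtain ⟨a, b, a', b', hK, h, hl⟩ := ih
    obtain ⟨c, d, c', d', hK', h', hl'⟩ := hrec _ hK
    refine ⟨c ++ a, b ++ d, c' ++ a', b' ++ d', by simpa using hK', ?_, by simp; omega⟩
    have : c ++ (a ++ z ++ b) ++ d = c' ++ (a' ++ z ++ b') ++ d' := by rw [h', h]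
    simpa using this

theorem exists_disjoint_occurrences (hdown : InfixDownwardClosed K)
    (hrec : ∀ c ∈ K, ∃ a b a' b', a ++ c ++ b ∈ K ∧ a ++ c ++ b = a' ++ c ++ b' ∧
      a.length < a'.length) (hz : z ∈ K) : ∃ m, z ++ m ++ z ∈ K := by
  obtain ⟨a, b, a', b', hK, h, hl⟩ := exists_distant_occurrences hrec hz z.length
  obtain ⟨m, rfl⟩ : a ++ z <+: a' := List.prefix_of_prefix_length_le (l₃ := a ++ z ++ b)
    ⟨b, rfl⟩ ⟨z ++ b', by simp [h]⟩ (by simpa using hl)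
  exact ⟨m, hdown _ _ ⟨a, b', by simp⟩ (h ▸ hK)⟩

theorem finite_avoiding_of_recurrent [Finite α] (hdown : InfixDownwardClosed K)
    (hwqo : ∀ f : ℕ → List α, (∀ n, f n ∈ K) → ∃ i j, i < j ∧ f i <:+: f j)
    (hdir : ∀ x ∈ K, ∀ y ∈ K, ∃ z ∈ K, x <:+: z ∧ y <:+: z)
    (hrec : ∀ c ∈ K, ∃ a b a' b', a ++ c ++ b ∈ K ∧ a ++ c ++ b = a' ++ c ++ b' ∧
      a.length < a'.length) (hu : u ∈ K) : {v ∈ K | ¬ u <:+: v}.Finite := by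
  by_contra hinf
  have long : ∀ n, ∃ t ∈ K, ¬ u <:+: t ∧ n < t.length := by
    intro n
    by_contra! hc
    exact hinf ((List.finite_length_le α n).subset fun t ht => hc t ht.1 ht.2)
  have hret : ∀ n, ∃ r ∈ K, u <+: r ∧ u <:+ r ∧ u.length < r.length ∧ n < r.length ∧
      ∀ a b, r = a ++ u ++ b → a = [] ∨ b = [] := by
    -- A long word avoiding u is placed in z together with u; W runs from u in one copy of z, across
    -- a second copy, to u in a third.
    intro n
    obtain ⟨t, htK, hut, hn⟩ := long (n + u.length)
    obtain ⟨z, hzK, ⟨a, b, hz⟩, htz⟩ := hdir u hu t htK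
    obtain ⟨m, hm⟩ := exists_disjoint_occurrences hdown hrec hzK
    obtain ⟨m', hm'⟩ := exists_disjoint_occurrences hdown hrec hm
    have hW : u ++ b ++ m ++ z ++ m' ++ a ++ u ∈ K :=
      hdown _ _ ⟨a, b ++ m ++ z, by rw [← hz]; simp⟩ hm'
    obtain ⟨r, hr, h1, h2, h3, h4⟩ := exists_return_word hut
      (htz.trans ⟨u ++ b ++ m, m' ++ a ++ u, by simp⟩)
      ⟨b ++ m ++ z ++ m' ++ a ++ u, by simp⟩ ⟨u ++ b ++ m ++ z ++ m' ++ a, rfl⟩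
    exact ⟨r, hdown _ _ hr hW, h1, h2, by omega, by omega, h4⟩
  set S := {r ∈ K | u <+: r ∧ u <:+ r ∧ u.length < r.length ∧
    ∀ a b, r = a ++ u ++ b → a = [] ∨ b = []} with hS
  have hSinf : S.Infinite := by
    intro hfin
    obtain ⟨N, hN⟩ := (hfin.image List.length).bddAbove
    obtain ⟨r, hrK, h1, h2, h3, h4, h5⟩ := hret N
    exact absurd (hN ⟨r, ⟨hrK, h1, h2, h3, h5⟩, rfl⟩) (not_le.2 h4)
  obtain ⟨i, j, hij, h⟩ := hwqo (fun n => (hSinf.natEmbedding S n).1)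
    fun n => (hSinf.natEmbedding S n).2.1
  obtain ⟨-, h1, h2, h3, -⟩ := (hSinf.natEmbedding S i).2
  obtain ⟨-, -, -, -, h4⟩ := (hSinf.natEmbedding S j).2
  exact hij.ne ((hSinf.natEmbedding S).injective
    (Subtype.ext (List.IsInfix.eq_of_return h1 h2 h3 h4 h)))

/-- In a common upper bound of v and w the two copies of c coincide, so the left parts are suffixes
of one word and the right parts prefixes of another; comparing lengths suffices. -/
theorem tame_containing_of_unique_occurrence {c : List α}
    (hdir : ∀ x ∈ K, ∀ y ∈ K, ∃ z ∈ K, x <:+: z ∧ y <:+: z)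
    (huniq : ∀ a b a' b', a ++ c ++ b ∈ K → a ++ c ++ b = a' ++ c ++ b' →
      a'.length ≤ a.length) : Tame (fun x y : List α => x <:+: y) {v ∈ K | c <:+: v} := by
  have hdec : ∀ v ∈ {v ∈ K | c <:+: v}, ∃ x y, x ++ c ++ y = v := fun v hv => hv.2
  choose! p q hpq using hdec
  refine Tame.of_grid (fun v => (p v).length) (fun v => (q v).length) ?_
  intro v hv w hw hp hq
  obtain ⟨z, hz, ⟨a, b, hab⟩, ⟨a', b', hab'⟩⟩ := hdir v hv.1 w hw.1
  have hv' : (a ++ p v) ++ c ++ (q v ++ b) = z := by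
    rw [← hab]; conv_rhs => rw [← hpq v hv]
    simp
  have hw' : (a' ++ p w) ++ c ++ (q w ++ b') = z := by
    rw [← hab']; conv_rhs => rw [← hpq w hw]
    simp
  have h1 := huniq _ _ _ _ (hv' ▸ hz) (hv'.trans hw'.symm)
  have h2 := huniq _ _ _ _ (hw' ▸ hz) (hw'.trans hv'.symm)
  have h3 := List.append_inj (hv'.trans hw'.symm) (by simp at h1 h2 ⊢; omega)
  have h4 := List.append_inj_left' h3.1 rfl
  obtain ⟨e, he⟩ : p v <:+ p w := List.suffix_of_suffix_length_le (l₃ := a ++ p v)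
    ⟨a, rfl⟩ ⟨a', h4.symm⟩ hp
  obtain ⟨f, hf⟩ : q v <+: q w := List.prefix_of_prefix_length_le (l₃ := q v ++ b)
    ⟨b, rfl⟩ ⟨b', h3.2.symm⟩ hq
  refine ⟨e, f, ?_⟩
  conv_lhs => rw [← hpq v hv]
  rw [← hpq w hw, ← he, ← hf]
  simp

theorem tame_of_tame_residuals [Finite α] (hdown : InfixDownwardClosed K)
    (hwqo : ∀ f : ℕ → List α, (∀ n, f n ∈ K) → ∃ i j, i < j ∧ f i <:+: f j)
    (ih : ∀ x ∈ K, Tame (fun x y : List α => x <:+: y) {v ∈ K | ¬ x <:+: v}) :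
    Tame (fun x y : List α => x <:+: y) K := by
  by_cases hdir : ∀ x ∈ K, ∀ y ∈ K, ∃ z ∈ K, x <:+: z ∧ y <:+: z
  · by_cases hrec : ∀ c ∈ K, ∃ a b a' b', a ++ c ++ b ∈ K ∧ a ++ c ++ b = a' ++ c ++ b' ∧
      a.length < a'.length
    · exact Tame.of_finite_residuals (fun _ => List.infix_rfl) fun u hu =>
        finite_avoiding_of_recurrent hdown hwqo hdir hrec hu
    · push Not at hrec
      obtain ⟨c, hc, huniq⟩ := hrec
      refine ((ih c hc).union (tame_containing_of_unique_occurrence hdir huniq)).subset ?_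
      intro v hv
      by_cases h : c <:+: v
      · exact Or.inr ⟨hv, h⟩
      · exact Or.inl ⟨hv, h⟩
  · push Not at hdir
    obtain ⟨x, hx, y, hy, h⟩ := hdir
    refine ((ih x hx).union (ih y hy)).subset fun v hv => ?_
    by_cases hxv : x <:+: v
    · exact Or.inr ⟨hv, h v hv hxv⟩
    · exact Or.inl ⟨hv, hxv⟩

theorem tame_of_wellQuasiOrdered [Finite α] (hdown : InfixDownwardClosed L)
    (hwqo : WellQuasiOrdered (infixOn L)) : Tame (fun x y : List α => x <:+: y) L := by
  -- A residual at x of the words avoiding `s` is the set attached to the child of `s` obtained by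
  -- appending x.
  have key : ∀ s : PairwiseSeq (BadPair (infixOn L)),
      Tame (fun x y : List α => x <:+: y) {v ∈ L | ∀ x ∈ s.1, ¬ x.1 <:+: v} := by
    intro s
    induction s using (wellFounded_bad hwqo).induction with
    | _ s ih =>
      refine tame_of_tame_residuals (fun u v huv hv => ⟨hdown u v huv hv.1, fun x hx h =>
        hv.2 x hx (h.trans huv)⟩) (fun f hf => hwqo fun n => ⟨f n, (hf n).1⟩) fun x hx => ?_
      refine (ih ⟨s.1 ++ [⟨x, hx.1⟩], ?_⟩ ⟨_, rfl⟩).subset ?_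
      · refine List.pairwise_append.2 ⟨s.2, List.pairwise_singleton _ _, fun a ha b hb => ?_⟩
        rw [List.mem_singleton.1 hb]
        exact hx.2 a ha
      · rintro v ⟨⟨hv, hs⟩, hxv⟩
        refine ⟨hv, fun y hy => ?_⟩
        rcases List.mem_append.1 hy with hy | hy
        · exact hs y hy
        · rwa [List.mem_singleton.1 hy]
  exact (key (PairwiseSeq.root _)).subset fun v hv => ⟨hv, fun x hx => by cases hx⟩

/-! ### Height, and the final bounds. -/

theorem rankBound_decreasing_length_lt (n : ℕ) :
    RankBound (DecreasingPair fun x y : List α => x <:+: y) {v | v.length < n} (triple 0 0 n) := by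
  induction n with
  | zero => exact RankBound.of_residuals fun x hx => absurd hx (Nat.not_lt_zero _)
  | succ n ih =>
    refine RankBound.of_residuals fun x hx => ⟨_, triple_lt_triple.2 (by simp),
      ih.mono (fun _ _ _ _ h => h) ?_ le_rfl⟩
    rintro y ⟨-, hyx, hxy⟩
    have hlt : y.length < x.length := lt_of_le_of_ne hyx.length_le fun he =>
      hxy (hyx.eq_of_length he ▸ List.infix_rfl)
    exact hlt.trans_le (Nat.lt_succ_iff.1 hx)

theorem rankBound_decreasing (L : Set (List α)) :
    RankBound (DecreasingPair fun x y : List α => x <:+: y) L (triple 0 1 0) :=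
  RankBound.of_residuals fun x _ => ⟨_, triple_lt_triple.2 (by simp),
    (rankBound_decreasing_length_lt (x.length + 1)).mono (fun _ _ _ _ h => h)
      (fun _ hy => Nat.lt_succ_of_le hy.2.1.length_le) le_rfl⟩

end Words

theorem mainTheorem5 {α : Type*} [Finite α] (L : Set (List α))
    (hdown : InfixDownwardClosed L) (hwqo : WellQuasiOrdered (infixOn L)) :
    maximalOrderType (infixOn L) hwqo < ω ^ 3 ∧
      ordinalHeight (infixOn L) hwqo ≤ ω ∧
      ordinalWidth (infixOn L) hwqo ≤ ω ^ 2 := by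
  obtain ⟨⟨m, hm⟩, n, hn⟩ := tame_of_wellQuasiOrdered hdown hwqo
  refine ⟨(hm.treeRank_le (f := Subtype.val) (fun _ _ h => h) (fun x => x.2) _).trans_lt ?_,
    ((rankBound_decreasing L).treeRank_le (f := Subtype.val) (fun _ _ h => h)
      (fun x => x.2) _).trans ?_,
    (hn.treeRank_le (f := Subtype.val) (fun _ _ h => h) (fun x => x.2) _).trans ?_⟩
  · rw [nsmul_triple, toOrdinal_triple, pow_succ', pow_succ', pow_one]
    simp only [mul_one, mul_zero, Nat.cast_zero, add_zero]
    gcongr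
    exacts [omega0_pos, omega0_pos, natCast_lt_omega0 m]
  · simp [toOrdinal_triple]
  · rw [nsmul_triple, toOrdinal_triple, pow_two]
    simp only [mul_one, mul_zero, Nat.cast_zero, add_zero, zero_add]
    gcongr
    exact (natCast_lt_omega0 n).le
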